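/- A function $\rho:(0,\infty)\to\mathbb{R}$ is called a zero proximate order if it is Lipschitz on every segment $[a,b]\subset(0,\infty)$, $\lim_{r\to\infty}\rho(r)=0$, and $\lim_{r\to\infty} r\,\rho'(r)\ln r=0$, where $\rho'(r)$ denotes the derived number of $\rho$ at $r$ of largest absolute value (a derived number at $r$ is a limit of difference quotients $(\rho(r+h_n)-\rho(r))/h_n$ with $h_n\to0$, $h_n\neq0$). Put $V(r)=r^{\rho(r)}$, and for an entire function $f$ put $M(r,f)=\max_{\varphi\in\mathbb{R}}|f(re^{i\varphi})|$. One says that $\rho(r)$ is a proximate order of $f$ if $$\varlimsup_{r\to\infty}\frac{\ln M(r,f)}{V(r)}\in(0,\infty).$$ **Theorem.** Let $\rho(r)$ be a given zero proximate order. There exists a transcendental entire function $f$ (that is, an entire function which is not a polynomial) such that $\rho(r)$ is a proximate order of $f$, if and only if $$\lim_{r\to\infty}\frac{\ln r}{V(r)}=0.$$ -/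

import Mathlib

open Filter Topology
open scoped NNReal Polynomial

/-- `d` is a derived number of `f` at `x`: a limit of difference quotients
`(f (x + h) - f x) / h` along some sequence (equivalently, a cluster point) as `h → 0`, `h ≠ 0`. -/
def IsDerivedNumber (f : ℝ → ℝ) (x d : ℝ) : Prop :=
  MapClusterPt d (𝓝[≠] (0 : ℝ)) (fun h : ℝ => (f (x + h) - f x) / h)

/-- The largest absolute value of a derived number of `f` at `x`. For `f` Lipschitz near `x`
the set below is nonempty and bounded (see `exists_isDerivedNumber_of_lipschitzOnWith` and
`IsDerivedNumber.abs_le_of_lipschitzOnWith`). -/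
noncomputable def maxAbsDerivedNumber (f : ℝ → ℝ) (x : ℝ) : ℝ :=
  sSup {t : ℝ | ∃ d : ℝ, IsDerivedNumber f x d ∧ t = |d|}

theorem eventually_abs_slope_le_of_lipschitzOnWith {f : ℝ → ℝ} {x a b : ℝ} {K : ℝ≥0}
    (hK : LipschitzOnWith K f (Set.Icc a b)) (ha : a < x) (hb : x < b) :
    ∀ᶠ h in 𝓝[≠] (0 : ℝ), |(f (x + h) - f x) / h| ≤ K := by
  have h1 : ∀ᶠ h in 𝓝 (0 : ℝ), x + h ∈ Set.Icc a b := by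
    have hc : Tendsto (fun h : ℝ => x + h) (𝓝 0) (𝓝 (x + 0)) :=
      (continuous_const.add continuous_id).tendsto 0
    rw [add_zero] at hc
    exact hc (Icc_mem_nhds ha hb)
  filter_upwards [h1.filter_mono nhdsWithin_le_nhds, self_mem_nhdsWithin] with h hh h0
  have h2 := hK.dist_le_mul (x + h) hh x ⟨ha.le, hb.le⟩
  rw [Real.dist_eq, Real.dist_eq, add_sub_cancel_left] at h2
  have h3 : 0 < |h| := abs_pos.mpr h0
  rw [abs_div, div_le_iff₀ h3]
  exact h2

theorem exists_isDerivedNumber_of_lipschitzOnWith {f : ℝ → ℝ} {x a b : ℝ} {K : ℝ≥0}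
    (hK : LipschitzOnWith K f (Set.Icc a b)) (ha : a < x) (hb : x < b) :
    ∃ d, IsDerivedNumber f x d := by
  have h1 := eventually_abs_slope_le_of_lipschitzOnWith hK ha hb
  have h2 : ∀ᶠ h in 𝓝[≠] (0 : ℝ), (f (x + h) - f x) / h ∈ Set.Icc (-(K : ℝ)) K :=
    h1.mono fun h hh => abs_le.mp hh
  obtain ⟨d, -, hd⟩ := isCompact_Icc.exists_mapClusterPt
    (tendsto_principal.mpr h2)
  exact ⟨d, hd⟩

theorem IsDerivedNumber.abs_le_of_lipschitzOnWith {f : ℝ → ℝ} {x a b d : ℝ} {K : ℝ≥0}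
    (hd : IsDerivedNumber f x d) (hK : LipschitzOnWith K f (Set.Icc a b))
    (ha : a < x) (hb : x < b) : |d| ≤ K := by
  have h1 := eventually_abs_slope_le_of_lipschitzOnWith hK ha hb
  have h2 : ∀ᶠ h in 𝓝[≠] (0 : ℝ), (f (x + h) - f x) / h ∈ Set.Icc (-(K : ℝ)) K :=
    h1.mono fun h hh => abs_le.mp hh
  have h3 := isClosed_Icc.mem_of_mapClusterPt hd h2
  exact abs_le.mpr h3

/-- A proximate order: a function on `(0, ∞)` (values of `ρ` at `r ≤ 0` are irrelevant) which is
Lipschitz on every segment `[a, b] ⊂ (0, ∞)`, has a finite limit at infinity, and satisfies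
`r ρ'(r) ln r → 0`, where `ρ'(r)` is the derived number of largest absolute value. -/
structure IsProximateOrder (ρ : ℝ → ℝ) : Prop where
  lipschitz : ∀ a b : ℝ, 0 < a → a ≤ b → ∃ K : ℝ≥0, LipschitzOnWith K ρ (Set.Icc a b)
  exists_tendsto : ∃ l : ℝ, Tendsto ρ atTop (𝓝 l)
  tendsto_derivedNumber :
    Tendsto (fun r : ℝ => r * maxAbsDerivedNumber ρ r * Real.log r) atTop (𝓝 0)

/-- A zero proximate order: a proximate order with limit `0` at infinity. -/
structure IsZeroProximateOrder (ρ : ℝ → ℝ) : Prop extends IsProximateOrder ρ where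
  tendsto_zero : Tendsto ρ atTop (𝓝 0)

/-- The function `V(r) = r ^ ρ(r)` (used for `r > 0`). -/
noncomputable def proximateV (ρ : ℝ → ℝ) (r : ℝ) : ℝ := r ^ ρ r

/-- The maximum modulus `M(r, f)`, the maximum of `|f (r e^{iφ})|` over real `φ`. -/
noncomputable def maxModulus (f : ℂ → ℂ) (r : ℝ) : ℝ :=
  ⨆ φ : ℝ, ‖f ((r : ℂ) * Complex.exp (Complex.I * (φ : ℂ)))‖

/-- A transcendental entire function: an entire function that is not a polynomial. -/
def IsTranscendentalEntire (f : ℂ → ℂ) : Prop :=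
  Differentiable ℂ f ∧ ¬ ∃ p : ℂ[X], ∀ z : ℂ, f z = p.eval z

/-- `ρ` is a proximate order of the entire function `f`: the upper limit of
`ln M(r, f) / V(r)` as `r → ∞`, taken in the extended reals, is a finite positive number. -/
def IsProximateOrderOf (ρ : ℝ → ℝ) (f : ℂ → ℂ) : Prop :=
  ∃ σ : ℝ, 0 < σ ∧
    limsup (fun r : ℝ => ((Real.log (maxModulus f r) / proximateV ρ r : ℝ) : EReal)) atTop
      = (σ : EReal)

/-!
In the variable `x = ln r` the hypotheses on `ρ` say that `ln V` has derivative tending to `0`, so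
`V` varies slowly. The only consequence needed is `V (e r) ≤ C V r` for large `r`
(`IsZeroProximateOrder.exists_proximateV_exp_one_mul_le`), which follows from a mean value
inequality for derived numbers (`sub_le_of_maxAbsDerivedNumber_le`).

If a transcendental entire function `f` has proximate order `ρ`, then `ln M(r, f) = O(V r)`, while
Cauchy's estimate for a nonzero Taylor coefficient of high index shows that `ln M(r, f)` dominates
every multiple of `ln r`; hence `ln r = o(V r)`.

Conversely, let `ln r = o(V r)`. Then the Legendre-type transform
`b n = inf_{r ≥ 1} (V r - n ln r)` is finite, and `f z = ∑ exp (b n) z ^ n` is the required function.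
By definition of `b`, each term satisfies `exp (b n) r ^ n ≤ exp (V r)`, and applying this at `e r`
gives the convergent majorant `exp (V (e r)) e ^ (-n)`, so `ln M(r, f) ≤ V (e r) + ln 2 = O(V r)`.
In the other direction, points `r n` where the infimum is almost attained tend to infinity, since
`V` is finite at every point, and there the single term of index `n` gives
`ln M(r n, f) ≥ V (r n) - 1`. The upper limit is therefore positive and finite.
-/

/-! ### The maximum modulus of a continuous function -/

theorem bddAbove_range_norm_circle {f : ℂ → ℂ} (hf : Continuous f) (r : ℝ) :
    BddAbove (Set.range fun φ : ℝ => ‖f ((r : ℂ) * Complex.exp (Complex.I * (φ : ℂ)))‖) := by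
  obtain ⟨C, hC⟩ := (isCompact_closedBall (0 : ℂ) |r|).exists_bound_of_continuousOn hf.continuousOn
  refine ⟨C, ?_⟩
  rintro _ ⟨φ, rfl⟩
  refine hC _ ?_
  rw [mul_comm Complex.I]
  simp [Complex.norm_exp_ofReal_mul_I]

theorem norm_le_maxModulus {f : ℂ → ℂ} (hf : Continuous f) {r : ℝ} {z : ℂ} (hz : ‖z‖ = r) :
    ‖f z‖ ≤ maxModulus f r := by
  have h := le_ciSup (bddAbove_range_norm_circle hf r) z.arg
  have h2 : (r : ℂ) * Complex.exp (Complex.I * (z.arg : ℂ)) = z := by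
    rw [mul_comm Complex.I, ← hz, Complex.norm_mul_exp_arg_mul_I]
  simp only [h2] at h
  exact h

theorem maxModulus_le {f : ℂ → ℂ} {r B : ℝ} (hr : 0 ≤ r) (h : ∀ z : ℂ, ‖z‖ = r → ‖f z‖ ≤ B) :
    maxModulus f r ≤ B := by
  refine ciSup_le fun φ => h _ ?_
  rw [mul_comm Complex.I]
  simp [Complex.norm_exp_ofReal_mul_I, abs_of_nonneg hr]

/-! ### Growth of transcendental entire functions -/

theorem IsTranscendentalEntire.exists_iteratedDeriv_ne_zero {f : ℂ → ℂ}
    (hf : IsTranscendentalEntire f) (n : ℕ) : ∃ m, n < m ∧ iteratedDeriv m f 0 ≠ 0 := by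
  by_contra! h
  refine hf.2 ⟨∑ k ∈ Finset.range (n + 1),
    Polynomial.monomial k ((k.factorial : ℂ)⁻¹ * iteratedDeriv k f 0), fun z => ?_⟩
  rw [← Complex.taylorSeries_eq_of_entire' 0 z hf.1, Polynomial.eval_finsetSum,
    tsum_eq_sum (s := Finset.range (n + 1))]
  · simp [Polynomial.eval_monomial]
  · intro k hk
    rw [h k (by simpa using hk)]
    simp

/-- Cauchy's estimate for the Taylor coefficients at the origin. -/
theorem norm_iteratedDeriv_div_mul_pow_le_maxModulus {f : ℂ → ℂ} (hf : Differentiable ℂ f) (n : ℕ)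
    {r : ℝ} (hr : 0 < r) :
    ‖iteratedDeriv n f 0‖ / n.factorial * r ^ n ≤ maxModulus f r := by
  have h := Complex.norm_iteratedDeriv_le_of_forall_mem_sphere_norm_le (c := 0) n hr
    hf.diffContOnCl (C := maxModulus f r)
    (fun z hz => norm_le_maxModulus hf.continuous (by simpa using hz))
  have hn : (0 : ℝ) < n.factorial := by exact_mod_cast n.factorial_pos
  rw [le_div_iff₀ (pow_pos hr n)] at h
  rw [div_mul_eq_mul_div, div_le_iff₀ hn]
  linarith

theorem IsTranscendentalEntire.eventually_mul_log_le {f : ℂ → ℂ}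
    (hf : IsTranscendentalEntire f) (n : ℕ) :
    ∀ᶠ r : ℝ in atTop, n * Real.log r ≤ Real.log (maxModulus f r) := by
  obtain ⟨m, hm, h0⟩ := hf.exists_iteratedDeriv_ne_zero n
  set c : ℝ := ‖iteratedDeriv m f 0‖ / m.factorial with hc
  have hcpos : 0 < c :=
    div_pos (norm_pos_iff.mpr h0) (by exact_mod_cast m.factorial_pos)
  filter_upwards [eventually_ge_atTop 1, eventually_ge_atTop (1 / c)] with r hr1 hrc
  have hr0 : 0 < r := by linarith
  rw [← Real.log_pow]
  refine Real.log_le_log (pow_pos hr0 n) ?_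
  refine le_trans ?_ (norm_iteratedDeriv_div_mul_pow_le_maxModulus hf.1 m hr0)
  rw [← hc]
  have h1 : 1 ≤ c * r := by rwa [div_le_iff₀' hcpos] at hrc
  calc r ^ n ≤ (c * r) * r ^ n := le_mul_of_one_le_left (by positivity) h1
    _ = c * r ^ (n + 1) := by ring
    _ ≤ c * r ^ m := by gcongr; assumption

theorem tendsto_log_div_of_isProximateOrderOf {ρ : ℝ → ℝ} {f : ℂ → ℂ}
    (hf : IsTranscendentalEntire f) (hρ : IsProximateOrderOf ρ f) :
    Tendsto (fun r : ℝ => Real.log r / proximateV ρ r) atTop (𝓝 0) := by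
  obtain ⟨σ, hσ, hlim⟩ := hρ
  have hup : ∀ᶠ r : ℝ in atTop, Real.log (maxModulus f r) / proximateV ρ r < σ + 1 := by
    have h : limsup (fun r : ℝ =>
        ((Real.log (maxModulus f r) / proximateV ρ r : ℝ) : EReal)) atTop
          < ((σ + 1 : ℝ) : EReal) := by
      rw [hlim]
      exact_mod_cast lt_add_one σ
    filter_upwards [eventually_lt_of_limsup_lt h] with r hr
    exact_mod_cast hr
  rw [Metric.tendsto_nhds]
  intro ε hε
  obtain ⟨n, hn⟩ := exists_nat_gt ((σ + 1) / ε)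
  have hn0 : (0 : ℝ) < n := lt_trans (by positivity) hn
  filter_upwards [hup, hf.eventually_mul_log_le n, eventually_ge_atTop 1] with r h1 h2 hr
  have hV : 0 < proximateV ρ r := Real.rpow_pos_of_pos (by linarith) _
  rw [dist_zero_right, Real.norm_eq_abs,
    abs_of_nonneg (div_nonneg (Real.log_nonneg hr) hV.le), div_lt_iff₀ hV]
  rw [div_lt_iff₀ hV] at h1
  rw [div_lt_iff₀ hε] at hn
  have h3 : n * Real.log r < n * (ε * proximateV ρ r) := by
    nlinarith
  exact lt_of_mul_lt_mul_left h3 hn0.le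

/-! ### A mean value inequality for derived numbers -/

theorem IsDerivedNumber.abs_le_maxAbsDerivedNumber {f : ℝ → ℝ} {x a b d : ℝ} {K : ℝ≥0}
    (hd : IsDerivedNumber f x d) (hK : LipschitzOnWith K f (Set.Icc a b))
    (ha : a < x) (hb : x < b) : |d| ≤ maxAbsDerivedNumber f x := by
  refine le_csSup ⟨K, ?_⟩ ⟨d, hd, rfl⟩
  rintro _ ⟨e, he, rfl⟩
  exact he.abs_le_of_lipschitzOnWith hK ha hb

/-- Otherwise the right slopes at `x`, which are bounded by the Lipschitz constant, would have a
cluster point `d ≥ c`, and `d` would be a derived number. -/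
theorem frequently_slope_lt_of_maxAbsDerivedNumber_lt {f : ℝ → ℝ} {x a b c : ℝ} {K : ℝ≥0}
    (hK : LipschitzOnWith K f (Set.Icc a b)) (ha : a < x) (hb : x < b)
    (hc : maxAbsDerivedNumber f x < c) : ∃ᶠ z in 𝓝[>] x, slope f x z < c := by
  intro hcon
  have hshift : Tendsto (fun h : ℝ => x + h) (𝓝[>] 0) (𝓝[>] x) := by
    refine tendsto_nhdsWithin_iff.mpr ⟨?_, ?_⟩
    · have : Tendsto (fun h : ℝ => x + h) (𝓝 0) (𝓝 (x + 0)) :=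
        (continuous_const.add continuous_id).tendsto 0
      rw [add_zero] at this
      exact this.mono_left nhdsWithin_le_nhds
    · filter_upwards [self_mem_nhdsWithin] with h hh
      simpa using hh
  have hle : 𝓝[>] (0 : ℝ) ≤ 𝓝[≠] 0 := nhdsWithin_mono _ fun h hh => ne_of_gt hh
  have hmem : ∀ᶠ h in 𝓝[>] (0 : ℝ), (f (x + h) - f x) / h ∈ Set.Icc c K := by
    filter_upwards [hshift.eventually hcon,
      (eventually_abs_slope_le_of_lipschitzOnWith hK ha hb).filter_mono hle] with h h1 h2
    refine ⟨?_, (abs_le.mp h2).2⟩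
    rw [slope_def_field, add_sub_cancel_left] at h1
    exact not_lt.mp h1
  obtain ⟨d, hd, hcl⟩ := isCompact_Icc.exists_mapClusterPt (tendsto_principal.mpr hmem)
  have hder : IsDerivedNumber f x d := hcl.mono hle
  have := hder.abs_le_maxAbsDerivedNumber hK ha hb
  linarith [hd.1, le_abs_self d]

theorem sub_le_of_maxAbsDerivedNumber_le {f : ℝ → ℝ} {a b a' b' c : ℝ} {K : ℝ≥0}
    (hK : LipschitzOnWith K f (Set.Icc a' b')) (ha : a' < a) (hab : a ≤ b) (hb : b ≤ b')
    (hc : ∀ x ∈ Set.Ico a b, maxAbsDerivedNumber f x ≤ c) : f b - f a ≤ c * (b - a) := by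
  have hB : ∀ x, HasDerivAt (fun x => f a + c * (x - a)) c x := fun x => by
    simpa using (((hasDerivAt_id x).sub_const a).const_mul c).const_add (f a)
  have h := image_le_of_liminf_slope_right_le_deriv_boundary (f := f) (a := a) (b := b)
    (B := fun x => f a + c * (x - a)) (B' := fun _ => c)
    (hK.continuousOn.mono (Set.Icc_subset_Icc ha.le hb)) (by simp)
    (fun x _ => (hB x).continuousAt.continuousWithinAt)
    (fun x _ => (hB x).hasDerivWithinAt)
    (fun x hx r hr => frequently_slope_lt_of_maxAbsDerivedNumber_lt hK
      (ha.trans_le hx.1) (hx.2.trans_le hb) ((hc x hx).trans_lt hr))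
    ⟨hab, le_rfl⟩
  linarith

/-- Since `ln V(e r) - ln V(r) = ρ(e r) + ln r * (ρ(e r) - ρ(r))`, it suffices to bound the last
product, and on `[r, e r]` the derived numbers of `ρ` are eventually at most `1 / (r ln r)`. -/
theorem IsZeroProximateOrder.exists_proximateV_exp_one_mul_le {ρ : ℝ → ℝ}
    (hρ : IsZeroProximateOrder ρ) :
    ∃ C : ℝ, ∀ᶠ r : ℝ in atTop, proximateV ρ (Real.exp 1 * r) ≤ C * proximateV ρ r := by
  refine ⟨Real.exp (Real.exp 1), ?_⟩
  have hexp : Tendsto (fun r : ℝ => Real.exp 1 * r) atTop atTop :=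
    tendsto_id.const_mul_atTop (Real.exp_pos 1)
  have h1 : ∀ᶠ r : ℝ in atTop, ρ (Real.exp 1 * r) ≤ 1 :=
    (hρ.tendsto_zero.comp hexp).eventually_le_const one_pos
  obtain ⟨R, hR⟩ := eventually_atTop.mp
    (hρ.tendsto_derivedNumber.eventually_le_const one_pos)
  filter_upwards [h1, eventually_ge_atTop R, eventually_gt_atTop 1] with r hr1 hrR hr
  have hr0 : 0 < r := by linarith
  have hlog : 0 < Real.log r := Real.log_pos hr
  have he : 1 ≤ Real.exp 1 := Real.one_le_exp zero_le_one
  have hre : r ≤ Real.exp 1 * r := le_mul_of_one_le_left hr0.le he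
  obtain ⟨K, hK⟩ := hρ.lipschitz (r / 2) (Real.exp 1 * r) (by positivity) (by linarith)
  have hmv := sub_le_of_maxAbsDerivedNumber_le hK (a := r) (by linarith) hre le_rfl
    (c := 1 / (r * Real.log r)) (fun x hx => by
      have hx0 : 0 < x := hr0.trans_le hx.1
      have hxlog : Real.log r ≤ Real.log x := Real.log_le_log hr0 hx.1
      have hb := hR x (hrR.trans hx.1)
      calc maxAbsDerivedNumber ρ x ≤ 1 / (x * Real.log x) := by
            rw [le_div_iff₀ (mul_pos hx0 (hlog.trans_le hxlog))]
            linarith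
        _ ≤ 1 / (r * Real.log r) :=
            one_div_le_one_div_of_le (mul_pos hr0 hlog)
              (mul_le_mul hx.1 hxlog hlog.le hx0.le))
  have hdiff : Real.log r * (ρ (Real.exp 1 * r) - ρ r) ≤ Real.exp 1 - 1 := by
    calc Real.log r * (ρ (Real.exp 1 * r) - ρ r)
        ≤ Real.log r * (1 / (r * Real.log r) * (Real.exp 1 * r - r)) := by gcongr
      _ = Real.exp 1 - 1 := by field_simp
  rw [proximateV, proximateV, Real.rpow_def_of_pos (by positivity), Real.rpow_def_of_pos hr0,
    ← Real.exp_add, Real.log_mul (Real.exp_pos 1).ne' hr0.ne', Real.log_exp]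
  refine Real.exp_le_exp.mpr ?_
  linarith

/-! ### The entire function attached to a majorant -/

/-- The transform `n ↦ inf_{r ≥ 1} (V r - n ln r)`: its value at `n` is the largest `b` such that
`exp b * r ^ n ≤ exp (V r)` for all `r ≥ 1`, provided that the infimum is finite. -/
noncomputable def logCoeff (V : ℝ → ℝ) (n : ℕ) : ℝ :=
  ⨅ r : Set.Ici (1 : ℝ), (V r - n * Real.log r)

/-- The power series whose `n`-th coefficient is the exponential of `logCoeff V n`. -/
noncomputable def majorantSeries (V : ℝ → ℝ) (z : ℂ) : ℂ :=
  ∑' n : ℕ, (Real.exp (logCoeff V n) : ℂ) * z ^ n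

theorem eventually_mul_log_le_of_tendsto {V : ℝ → ℝ} (hpos : ∀ r, 1 ≤ r → 0 < V r)
    (hlog : Tendsto (fun r => Real.log r / V r) atTop (𝓝 0)) (n : ℕ) :
    ∀ᶠ r in atTop, n * Real.log r ≤ V r := by
  filter_upwards [hlog.eventually_le_const (u := 1 / ((n : ℝ) + 1)) (by positivity),
    eventually_ge_atTop 1] with r h hr
  rw [div_le_div_iff₀ (hpos r hr) (by positivity)] at h
  nlinarith [Real.log_nonneg hr]

section Majorant

variable {V : ℝ → ℝ}

theorem bddBelow_range_sub_mul_log (hpos : ∀ r, 1 ≤ r → 0 < V r)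
    (hlog : Tendsto (fun r => Real.log r / V r) atTop (𝓝 0)) (n : ℕ) :
    BddBelow (Set.range fun r : Set.Ici (1 : ℝ) => V r - n * Real.log r) := by
  obtain ⟨R, hR⟩ := eventually_atTop.mp (eventually_mul_log_le_of_tendsto hpos hlog n)
  refine ⟨-(n * Real.log (max R 1)), ?_⟩
  rintro _ ⟨⟨r, hr⟩, rfl⟩
  have hr1 : 1 ≤ r := hr
  have hn : (0 : ℝ) ≤ n := n.cast_nonneg
  rcases le_total R r with h | h
  · have h1 := hR r h
    have h2 := mul_nonneg hn (Real.log_nonneg (le_max_right R 1))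
    simp only
    linarith
  · have h1 := hpos r hr1
    have h2 := mul_le_mul_of_nonneg_left
      (Real.log_le_log (by linarith) (h.trans (le_max_left R 1))) hn
    simp only
    linarith

theorem exp_logCoeff_mul_pow_le (hpos : ∀ r, 1 ≤ r → 0 < V r)
    (hlog : Tendsto (fun r => Real.log r / V r) atTop (𝓝 0)) (n : ℕ) {r : ℝ} (hr : 1 ≤ r) :
    Real.exp (logCoeff V n) * r ^ n ≤ Real.exp (V r) := by
  have h : logCoeff V n ≤ V r - n * Real.log r :=
    ciInf_le (bddBelow_range_sub_mul_log hpos hlog n) ⟨r, hr⟩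
  rw [← Real.exp_log (show 0 < r by linarith), ← Real.exp_nat_mul, ← Real.exp_add,
    Real.exp_log (show 0 < r by linarith)]
  exact Real.exp_le_exp.mpr (by linarith)

theorem norm_majorantSeries_term_le (hpos : ∀ r, 1 ≤ r → 0 < V r)
    (hlog : Tendsto (fun r => Real.log r / V r) atTop (𝓝 0)) (n : ℕ) {r : ℝ} (hr : 1 ≤ r)
    {z : ℂ} (hz : ‖z‖ ≤ r) :
    ‖(Real.exp (logCoeff V n) : ℂ) * z ^ n‖ ≤
      Real.exp (V (Real.exp 1 * r)) * Real.exp (-1) ^ n := by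
  have he : 1 ≤ Real.exp 1 := Real.one_le_exp zero_le_one
  have h := exp_logCoeff_mul_pow_le hpos hlog n (one_le_mul_of_one_le_of_one_le he hr)
  have h1 : Real.exp 1 ^ n * Real.exp (-1) ^ n = 1 := by
    rw [← mul_pow, ← Real.exp_add]
    simp
  calc ‖(Real.exp (logCoeff V n) : ℂ) * z ^ n‖ = Real.exp (logCoeff V n) * ‖z‖ ^ n := by
        rw [norm_mul, norm_pow, Complex.norm_real, Real.norm_eq_abs, Real.abs_exp]
    _ ≤ Real.exp (logCoeff V n) * r ^ n := by gcongr
    -- The gain `e ^ (-n)` comes from passing from `r` to `e r`.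
    _ = Real.exp (logCoeff V n) * (Real.exp 1 * r) ^ n * Real.exp (-1) ^ n := by
        rw [mul_pow]
        linear_combination (-(Real.exp (logCoeff V n) * r ^ n)) * h1
    _ ≤ _ := by gcongr

theorem exp_neg_one_le_half : Real.exp (-1) ≤ 1 / 2 := by
  rw [Real.exp_neg, ← one_div]
  exact one_div_le_one_div_of_le two_pos (by linarith [Real.add_one_le_exp (1 : ℝ)])

theorem summable_exp_mul_exp_neg_one_pow (A : ℝ) :
    Summable fun n : ℕ => A * Real.exp (-1) ^ n :=
  (summable_geometric_of_lt_one (Real.exp_pos _).le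
    (by linarith [exp_neg_one_le_half])).mul_left A

theorem differentiable_majorantSeries (hpos : ∀ r, 1 ≤ r → 0 < V r)
    (hlog : Tendsto (fun r => Real.log r / V r) atTop (𝓝 0)) :
    Differentiable ℂ (majorantSeries V) := by
  intro z
  have h := Complex.differentiableOn_tsum_of_summable_norm
    (F := fun (n : ℕ) (w : ℂ) => (Real.exp (logCoeff V n) : ℂ) * w ^ n)
    (U := Metric.ball 0 (‖z‖ + 1))
    (summable_exp_mul_exp_neg_one_pow (Real.exp (V (Real.exp 1 * (‖z‖ + 1)))))
    (fun n => by fun_prop) Metric.isOpen_ball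
    (fun n w hw => norm_majorantSeries_term_le hpos hlog n (by linarith [norm_nonneg z])
      (by simpa using (mem_ball_zero_iff.mp hw).le))
  exact h.differentiableAt (Metric.isOpen_ball.mem_nhds (by simp))

theorem norm_majorantSeries_le (hpos : ∀ r, 1 ≤ r → 0 < V r)
    (hlog : Tendsto (fun r => Real.log r / V r) atTop (𝓝 0)) {r : ℝ} (hr : 1 ≤ r) {z : ℂ}
    (hz : ‖z‖ ≤ r) : ‖majorantSeries V z‖ ≤ 2 * Real.exp (V (Real.exp 1 * r)) := by
  have hlt : Real.exp (-1) < 1 := by linarith [exp_neg_one_le_half]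
  have h := tsum_of_norm_bounded
    ((hasSum_geometric_of_lt_one (Real.exp_pos (-1)).le hlt).mul_left
      (Real.exp (V (Real.exp 1 * r))))
    (fun n => norm_majorantSeries_term_le hpos hlog n hr hz)
  refine h.trans ?_
  rw [mul_comm]
  gcongr
  rw [inv_le_comm₀ (by linarith) two_pos]
  linarith [exp_neg_one_le_half]

theorem exp_logCoeff_mul_pow_le_norm (hpos : ∀ r, 1 ≤ r → 0 < V r)
    (hlog : Tendsto (fun r => Real.log r / V r) atTop (𝓝 0)) (n : ℕ) {r : ℝ} (hr : 1 ≤ r) :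
    Real.exp (logCoeff V n) * r ^ n ≤ ‖majorantSeries V r‖ := by
  have hr0 : 0 ≤ r := by linarith
  have hs : Summable fun n : ℕ => Real.exp (logCoeff V n) * r ^ n := by
    refine Summable.of_nonneg_of_le (fun n => by positivity) (fun n => ?_)
      (summable_exp_mul_exp_neg_one_pow (Real.exp (V (Real.exp 1 * r))))
    have h := norm_majorantSeries_term_le hpos hlog n hr (z := (r : ℂ))
      (by simp [abs_of_nonneg hr0])
    rwa [norm_mul, norm_pow, Complex.norm_real, Complex.norm_real, Real.norm_eq_abs,
      Real.norm_eq_abs, Real.abs_exp, abs_of_nonneg hr0] at h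
  have hreal : majorantSeries V r =
      ((∑' n : ℕ, Real.exp (logCoeff V n) * r ^ n : ℝ) : ℂ) := by
    rw [majorantSeries, Complex.ofReal_tsum]
    simp
  rw [hreal, Complex.norm_real, Real.norm_eq_abs]
  exact (hs.le_tsum n fun k _ => by positivity).trans (le_abs_self _)

/-- The series is not a polynomial because all of its coefficients are positive. -/
theorem isTranscendentalEntire_majorantSeries (hpos : ∀ r, 1 ≤ r → 0 < V r)
    (hlog : Tendsto (fun r => Real.log r / V r) atTop (𝓝 0)) :
    IsTranscendentalEntire (majorantSeries V) := by
  refine ⟨differentiable_majorantSeries hpos hlog, ?_⟩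
  rintro ⟨p, hp⟩
  -- On the positive axis `p` is `O(r ^ d)`, but the series exceeds a positive multiple of
  -- `r ^ (d + 1)`.
  set d := p.natDegree
  set c := Real.exp (logCoeff V (d + 1)) with hc
  set S := ∑ i ∈ Finset.range (d + 1), ‖p.coeff i‖ with hS
  have hS0 : 0 ≤ S := Finset.sum_nonneg fun i _ => norm_nonneg _
  have hcpos : 0 < c := Real.exp_pos _
  set r : ℝ := S / c + 1 with hr
  have hr1 : 1 ≤ r := by linarith [div_nonneg hS0 hcpos.le]
  have hr0 : 0 < r := by linarith
  have hlow := exp_logCoeff_mul_pow_le_norm hpos hlog (d + 1) hr1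
  have hup : ‖majorantSeries V r‖ ≤ S * r ^ d := by
    rw [hp, Polynomial.eval_eq_sum_range, hS, Finset.sum_mul]
    refine norm_sum_le_of_le _ fun i hi => ?_
    rw [norm_mul, norm_pow, Complex.norm_real, Real.norm_eq_abs, abs_of_pos hr0]
    gcongr
    exact Nat.lt_succ_iff.mp (Finset.mem_range.mp hi)
  have h : c * r * r ^ d ≤ S * r ^ d := by
    calc c * r * r ^ d = c * r ^ (d + 1) := by ring
      _ ≤ S * r ^ d := hlow.trans hup
  have h2 : c * r ≤ S := le_of_mul_le_mul_right h (by positivity)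
  have h3 : c * r = S + c := by
    rw [hr]
    field_simp
  linarith

/-- Points at which the infimum defining `logCoeff V n` is nearly attained leave every bounded set
as `n → ∞`, and at such points the `n`-th term alone has the size of `exp (V r)`. -/
theorem frequently_exp_sub_one_le_norm (hpos : ∀ r, 1 ≤ r → 0 < V r)
    (hlog : Tendsto (fun r => Real.log r / V r) atTop (𝓝 0)) :
    ∃ᶠ r : ℝ in atTop, Real.exp (V r - 1) ≤ ‖majorantSeries V r‖ := by
  rw [frequently_atTop]
  intro R₀
  set R := max R₀ 1
  have hR1 : 1 ≤ R := le_max_right _ _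
  have hR0 : 0 < R := by linarith
  set t := Real.exp 1 * R with ht
  have ht1 : 1 ≤ t := one_le_mul_of_one_le_of_one_le (Real.one_le_exp zero_le_one) hR1
  have hlogt : Real.log t = 1 + Real.log R := by
    rw [ht, Real.log_mul (Real.exp_pos 1).ne' hR0.ne', Real.log_exp]
  -- If the near-minimiser were at most `R`, comparison with `t = e R` would give `n < V t + 1`.
  obtain ⟨n, hn⟩ := exists_nat_gt (V t + 1)
  obtain ⟨⟨r, hr⟩, hrn⟩ := exists_lt_of_ciInf_lt (lt_add_one (logCoeff V n))
  have hr1 : 1 ≤ r := hr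
  have hr0 : 0 < r := by linarith
  simp only at hrn
  have hbt : logCoeff V n ≤ V t - n * Real.log t :=
    ciInf_le (bddBelow_range_sub_mul_log hpos hlog n) ⟨t, ht1⟩
  refine ⟨r, ?_, ?_⟩
  · refine (le_max_left R₀ 1).trans (le_of_lt ?_)
    by_contra! hle
    have h1 : (n : ℝ) * Real.log r ≤ n * Real.log R :=
      mul_le_mul_of_nonneg_left (Real.log_le_log hr0 hle) n.cast_nonneg
    have h2 := hpos r hr1
    rw [hlogt] at hbt
    linarith
  · refine le_trans ?_ (exp_logCoeff_mul_pow_le_norm hpos hlog n hr1)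
    have h : r ^ n = Real.exp (n * Real.log r) := by
      rw [Real.exp_nat_mul, Real.exp_log hr0]
    rw [h, ← Real.exp_add]
    exact Real.exp_le_exp.mpr (by linarith)

end Majorant

theorem isProximateOrderOf_majorantSeries {ρ : ℝ → ℝ} (hρ : IsZeroProximateOrder ρ)
    (hlog : Tendsto (fun r : ℝ => Real.log r / proximateV ρ r) atTop (𝓝 0)) :
    IsProximateOrderOf ρ (majorantSeries (proximateV ρ)) := by
  have hpos : ∀ r, 1 ≤ r → 0 < proximateV ρ r := fun r hr =>
    Real.rpow_pos_of_pos (by linarith) _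
  have hcont := (differentiable_majorantSeries hpos hlog).continuous
  obtain ⟨C, hC⟩ := hρ.exists_proximateV_exp_one_mul_le
  have hV2 : ∀ᶠ r in atTop, 2 ≤ proximateV ρ r := by
    filter_upwards [eventually_mul_log_le_of_tendsto hpos hlog 1,
      Real.tendsto_log_atTop.eventually_ge_atTop 2] with r h1 h2
    rw [Nat.cast_one, one_mul] at h1
    linarith
  have hlow : ∃ᶠ r : ℝ in atTop, ((1 / 2 : ℝ) : EReal) ≤
      ((Real.log (maxModulus (majorantSeries (proximateV ρ)) r) / proximateV ρ r : ℝ) :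
        EReal) := by
    refine ((frequently_exp_sub_one_le_norm hpos hlog).and_eventually
      (hV2.and (eventually_ge_atTop 1))).mono ?_
    rintro r ⟨h1, h2, hr⟩
    have h3 := h1.trans (norm_le_maxModulus hcont (r := r)
      (by simp [abs_of_nonneg (zero_le_one.trans hr)]))
    have h4 := (Real.le_log_iff_exp_le ((Real.exp_pos _).trans_le h3)).mpr h3
    rw [EReal.coe_le_coe_iff, le_div_iff₀ (hpos r hr)]
    linarith
  have hup : ∀ᶠ r : ℝ in atTop,
      ((Real.log (maxModulus (majorantSeries (proximateV ρ)) r) / proximateV ρ r : ℝ) : EReal)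
        ≤ ((C + 1 : ℝ) : EReal) := by
    filter_upwards [hC, hV2, eventually_ge_atTop 1] with r h1 h2 hr
    have h3 : maxModulus (majorantSeries (proximateV ρ)) r
        ≤ 2 * Real.exp (proximateV ρ (Real.exp 1 * r)) :=
      maxModulus_le (by linarith) fun z hz => norm_majorantSeries_le hpos hlog hr hz.le
    have h0 : 0 < maxModulus (majorantSeries (proximateV ρ)) r := by
      refine lt_of_lt_of_le ?_ ((exp_logCoeff_mul_pow_le_norm hpos hlog 0 hr).trans
        (norm_le_maxModulus hcont (by simp [abs_of_nonneg (zero_le_one.trans hr)])))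
      simp [Real.exp_pos]
    have h4 := Real.log_le_log h0 h3
    rw [Real.log_mul two_ne_zero (Real.exp_pos _).ne', Real.log_exp] at h4
    rw [EReal.coe_le_coe_iff, div_le_iff₀ (hpos r hr)]
    linarith [Real.log_two_lt_d9]
  have hL1 := le_limsup_of_frequently_le' hlow
  have hL2 := limsup_le_of_le (h := hup)
  refine ⟨_, ?_, (EReal.coe_toReal (ne_top_of_le_ne_top (EReal.coe_ne_top _) hL2)
    (ne_bot_of_le_ne_bot (EReal.coe_ne_bot _) hL1)).symm⟩
  rw [← EReal.coe_toReal (ne_top_of_le_ne_top (EReal.coe_ne_top _) hL2)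
    (ne_bot_of_le_ne_bot (EReal.coe_ne_bot _) hL1), EReal.coe_le_coe_iff] at hL1
  linarith

/-! ### The characterization of the proximate orders -/

theorem mainTheorem1 (ρ : ℝ → ℝ) (hρ : IsZeroProximateOrder ρ) :
    (∃ f : ℂ → ℂ, IsTranscendentalEntire f ∧ IsProximateOrderOf ρ f) ↔
      Tendsto (fun r : ℝ => Real.log r / proximateV ρ r) atTop (𝓝 0) := by
  constructor
  · rintro ⟨f, hf, hfρ⟩
    exact tendsto_log_div_of_isProximateOrderOf hf hfρ
  · intro hlog
    exact ⟨majorantSeries (proximateV ρ),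
      isTranscendentalEntire_majorantSeries
        (fun r hr => Real.rpow_pos_of_pos (by linarith) _) hlog,
      isProximateOrderOf_majorantSeries hρ hlog⟩
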